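/- **Theorem.** Let $k=3$, $d=1$, and let $\mathcal X_n$ be the set of matrices $X\in\mathbb R^{n\times k}$ all of whose rows are standard basis vectors. An $n\times d$ matrix $A$ is presented in a *turnstile stream* if it is initialized to $0$ and receives a finite sequence of entrywise updates $A_{i,j}\gets A_{i,j}+\Delta$ with $\Delta\in\mathbb R$. Consider a randomized streaming algorithm which makes $r$ passes over the stream, retains only $M$ bits of memory from one update to the next, and, at the end, outputs centers $\tilde D\in\mathbb R^{k\times d}$. Its coin tosses, a clock showing the pass and the position in the stream, and its computation within a step are not charged. Suppose that, for every stream of a class $\mathcal S$ of turnstile streams, with $A\in\mathbb R^{n\times d}$ the matrix that the stream presents, it holds with probability at least $2/3$ that $$\min_{X\in\mathcal X_n}\|X\tilde D-A\|_F^2 \;<\; 2\min_{X\in\mathcal X_n,\;D\in\mathbb R^{k\times d}}\|XD-A\|_F^2 ,$$ where, if the right-hand side is $0$, this is understood as $\min_{X\in\mathcal X_n}\|X\tilde D-A\|_F^2=0$. Then the algorithm needs $\Omega(n)$ bits of space for every constant number of passes: for every $r$ there are $c>0$ and $n_0$, depending only on $r$, such that for all $n\ge n_0$, every class $\mathcal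 S$ of turnstile streams for $n\times d$ matrices that contains at least all those streams during which all entries of the matrix are always integers of absolute value at most $3$ (for example, the class of all turnstile streams), and every algorithm as above, one has $M\ge c\,n$. -/

import Mathlib

open MeasureTheory

universe u

noncomputable section

namespace KMeansStream

/-! ## The k-means objective -/

/-- The set `𝒳` of assignment matrices: `n × k` matrices all of whose rows are standard basis
vectors. -/
def assignments (n k : ℕ) : Set (Matrix (Fin n) (Fin k) ℝ) :=
  {X | ∀ i, ∃ j, X i = Pi.single j 1}

section Cost

attribute [local instance] Matrix.frobeniusNormedAddCommGroup

/-- The squared Frobenius norm `‖M‖_F ^ 2`. -/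
def frobSq {n d : ℕ} (M : Matrix (Fin n) (Fin d) ℝ) : ℝ := ‖M‖ ^ 2

end Cost

/-- `min_{X ∈ 𝒳} ‖X D - A‖_F ^ 2`, the k-means cost of the centers `D` (the rows of `D`) on the
points `A` (the rows of `A`). -/
def centersCost {n d k : ℕ} (A : Matrix (Fin n) (Fin d) ℝ) (D : Matrix (Fin k) (Fin d) ℝ) : ℝ :=
  ⨅ X : assignments n k, frobSq (X.1 * D - A)

/-- `min_{X ∈ 𝒳, D} ‖X D - A‖_F ^ 2`, the optimal k-means cost. -/
def optCost {n d : ℕ} (k : ℕ) (A : Matrix (Fin n) (Fin d) ℝ) : ℝ :=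
  ⨅ p : assignments n k × Matrix (Fin k) (Fin d) ℝ, frobSq (p.1.1 * p.2 - A)

/-- The centers `D` cost less than twice the optimum. When the optimum is `0` this is read as:
`D` has cost `0` (no centers satisfy the strict inequality then). -/
def BetterThanTwo {n d k : ℕ} (A : Matrix (Fin n) (Fin d) ℝ) (D : Matrix (Fin k) (Fin d) ℝ) :
    Prop :=
  centersCost A D < 2 * optCost k A ∨ centersCost A D = 0

/-! ## Turnstile streams -/

/-- The entrywise update `A row col ← A row col + val`. -/
structure Update (n d : ℕ) where
  row : Fin n
  col : Fin d
  val : ℝ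

/-- The matrix presented by a turnstile stream: it starts at `0` and receives the updates in
order. -/
def streamMatrix {n d : ℕ} (σ : List (Update n d)) : Matrix (Fin n) (Fin d) ℝ :=
  σ.foldl (fun A x => A + Matrix.single x.row x.col x.val) 0

/-- At every moment of the stream all the entries of the matrix are integers of absolute value
at most `B`. -/
def IntegerBounded {n d : ℕ} (B : ℤ) (σ : List (Update n d)) : Prop :=
  ∀ τ, τ <+: σ → ∀ i j, ∃ z : ℤ, |z| ≤ B ∧ streamMatrix τ i j = z

/-! ## Randomized multi-pass streaming algorithms -/

/-- The contents of a memory of `M` bits. -/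
abbrev Memory (M : ℕ) : Type := Fin M → Bool

/-- A randomized streaming algorithm with `M` bits of space for `n × d` matrices that outputs `k`
centers in `ℝ ^ d`. Here `ω : Ω` is the outcome of all of its coin tosses.

All that it keeps from one update of the stream to the next is a memory of `M` bits. The random
string `ω`, the number `p` of the current pass, the position `t` in the stream and the work done
inside a single step are free of charge. In particular, algorithms that toss fresh coins
in every step are covered (`ω` is the sequence of all tosses), as are those that can reread all
of their coins. The arithmetic is not restricted, and the algorithm may depend on `n` arbitrarily:
it is only the space that counts. -/
structure StreamingAlgorithm (Ω : Type u) [MeasurableSpace Ω] (n d k M : ℕ) where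
  /-- The initial memory. -/
  init : Ω → Memory M
  /-- `step ω p t m x` is the memory after the update `x` at position `t` of pass `p` is read with
  memory `m`. -/
  step : Ω → ℕ → ℕ → Memory M → Update n d → Memory M
  /-- `output ω t m` are the centers that are output at the end of the last pass over a stream of
  length `t`, if the memory is `m`. -/
  output : Ω → ℕ → Memory M → Matrix (Fin k) (Fin d) ℝ
  measurable_init : Measurable init
  measurable_step : ∀ p t m x, Measurable fun ω => step ω p t m x
  measurable_output : ∀ t m i j, Measurable fun ω => output ω t m i j

namespace StreamingAlgorithm

variable {Ω : Type u} [MeasurableSpace Ω] {n d k M : ℕ}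

/-- Read the given updates, the first of which is at position `t` of the stream, in pass `p`,
starting with the given memory. -/
def readFrom (alg : StreamingAlgorithm Ω n d k M) (ω : Ω) (p : ℕ) :
    ℕ → List (Update n d) → Memory M → Memory M
  | _, [], m => m
  | t, x :: σ, m => alg.readFrom ω p (t + 1) σ (alg.step ω p t m x)

/-- The memory after `r` passes over the stream `σ`. -/
def memoryAfter (alg : StreamingAlgorithm Ω n d k M) (ω : Ω) (σ : List (Update n d)) :
    ℕ → Memory M
  | 0 => alg.init ω
  | r + 1 => alg.readFrom ω r 0 σ (alg.memoryAfter ω σ r)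

/-- The centers that are output after `r` passes over the stream `σ`. -/
def result (alg : StreamingAlgorithm Ω n d k M) (r : ℕ) (ω : Ω) (σ : List (Update n d)) :
    Matrix (Fin k) (Fin d) ℝ :=
  alg.output ω σ.length (alg.memoryAfter ω σ r)

/-- On every stream of the class `𝒮`, the algorithm, with `r` passes, outputs with probability at
least `2 / 3` centers of cost less than twice the optimum. -/
def SolvesCenters (alg : StreamingAlgorithm Ω n d k M) (P : Measure Ω) (r : ℕ)
    (𝒮 : Set (List (Update n d))) : Prop :=
  ∀ σ ∈ 𝒮, 2 / 3 ≤ P {ω | BetterThanTwo (streamMatrix σ) (alg.result r ω σ)}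

end StreamingAlgorithm

end KMeansStream

end

namespace KMeansStream

/-! ## A corruption bound for set disjointness -/

section Corruption

variable {ι : Type*} [Fintype ι] [DecidableEq ι]

/-! The reduction is from set disjointness on `N = n - 3` points. The stream of a pair `x`, `y` adds
both indicator vectors and pads with the entries 0, 1, 3. If the sets are disjoint, all entries lie
in {0, 1, 3}, so the optimum is 0 and the centers must be exactly these values
(`hasPaddingCenters_of_disjoint`). If they share one element, an entry 2 appears: the optimum is at
most 1/2, while the centers 0, 1, 3 cost at least 1 (`not_betterThanTwo_of_meet`). Hence the output
is {0, 1, 3} with probability at least 2/3 on disjoint pairs and at most 1/3 on pairs meeting once.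

For fixed coins, recording the memory in the middle and at the end of every pass writes the
indicator of this event as a sum of `K = 2 ^ (M * (2 * r + 1))` rectangles `f x * g y`
(`isRectangleSum_accept`). By Razborov's corruption argument (`corruption_bound`), the probability
weight of a rectangle on hard pairs meeting once is at least 0.52 times its weight on hard disjoint
pairs, up to an exponentially small error. Since 0.52 · 2/3 > 1/3, the `K` errors together must make
up a constant, so `K` is exponential in `N` and `M` is linear in `n`. -/

lemma sum_insert_add_erase (φ : Finset ι → ℝ) (i : ι) :
    ∑ T, (φ (insert i T) + φ (T.erase i)) = 2 * ∑ T, φ T := by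
  have h1 : ∀ T : Finset ι, φ (insert i T) + φ (T.erase i) = φ T + φ (symmDiff T {i}) := by
    intro T
    by_cases h : i ∈ T
    · rw [Finset.insert_eq_of_mem h]
      congr 2
      ext a
      simp only [Finset.mem_erase, Finset.mem_symmDiff, Finset.mem_singleton]
      grind
    · rw [Finset.erase_eq_of_notMem h, add_comm]
      congr 2
      ext a
      simp only [Finset.mem_insert, Finset.mem_symmDiff, Finset.mem_singleton]
      grind
  have h2 : ∑ T : Finset ι, φ (symmDiff T {i}) = ∑ T, φ T :=
    Equiv.sum_comp (Function.Involutive.toPerm (fun T : Finset ι => symmDiff T {i})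
      (fun T => by simp)) φ
  rw [Finset.sum_congr rfl fun T _ => h1 T, Finset.sum_add_distrib, h2]
  ring

lemma sum_insert (φ : Finset ι → ℝ) (i : ι) :
    ∑ T, φ (insert i T) = 2 * ∑ T, if i ∈ T then φ T else 0 := by
  rw [← sum_insert_add_erase _ i]
  simp

lemma sum_erase (φ : Finset ι → ℝ) (i : ι) :
    ∑ T : Finset ι, φ (T.erase i) = 2 * ∑ T, if i ∈ T then 0 else φ T := by
  rw [← sum_insert_add_erase _ i]
  simp

lemma sum_prod_ite (u v : ι → ℝ) :
    ∑ z : Finset ι, ∏ i, (if i ∈ z then u i else v i) = ∏ i, (u i + v i) := by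
  rw [Finset.prod_add, Finset.powerset_univ]
  refine Finset.sum_congr rfl fun z _ => ?_
  rw [Finset.prod_ite]
  congr 1
  · exact Finset.prod_congr (by ext; simp) fun _ _ => rfl
  · exact Finset.prod_congr (by ext; simp) fun _ _ => rfl

/-- The base of the exponential bound on a family of sets with biased coordinates. -/
noncomputable def biasBase : ℝ := 5 / 6 * (3 / 2) ^ (2 / 5 : ℝ)

lemma biasBase_pos : 0 < biasBase := by unfold biasBase; positivity

lemma biasBase_lt_one : biasBase < 1 := by
  -- The fifth power is (5/6)^5 · (3/2)^2 = 28125/31104.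
  have h : biasBase ^ 5 < 1 := by
    unfold biasBase
    rw [mul_pow, ← Real.rpow_natCast (_ ^ _), ← Real.rpow_mul (by norm_num)]
    norm_num
  by_contra hc
  exact absurd (one_le_pow₀ (not_lt.1 hc)) (not_le.2 h)

/-- A function whose every coordinate in `B` takes the value prescribed by `s` with relative
weight at most `2 / 5` has small total weight. -/
lemma sum_le_biasBase_pow (f : Finset ι → ℝ) (h0 : ∀ z, 0 ≤ f z) (h1 : ∀ z, f z ≤ 1)
    (B S : Finset ι)
    (hB : ∀ i ∈ B, ∑ z, (if (i ∈ z ↔ i ∈ S) then f z else 0) ≤ 2 / 5 * ∑ z, f z) :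
    ∑ z, f z ≤ 2 ^ Fintype.card ι * biasBase ^ B.card := by
  set W := ∑ z, f z with hW
  have hW0 : 0 ≤ W := Finset.sum_nonneg fun z _ => h0 z
  rcases hW0.eq_or_lt with h | hWpos
  · rw [← h]; have := biasBase_pos; positivity
  let K : Finset ι → ℕ := fun z => (B.filter fun i => (i ∈ z ↔ i ∈ S)).card
  let c : ℝ := Real.log (3 / 2)
  have hc : 0 < c := Real.log_pos (by norm_num)
  have hKsum : ∑ z, f z * K z ≤ 2 / 5 * B.card * W := by
    calc ∑ z, f z * K z
        = ∑ z, ∑ i ∈ B, (if (i ∈ z ↔ i ∈ S) then f z else 0) := by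
          refine Finset.sum_congr rfl fun z _ => ?_
          rw [← Finset.sum_filter, Finset.sum_const, nsmul_eq_mul, mul_comm]
      _ = ∑ i ∈ B, ∑ z, (if (i ∈ z ↔ i ∈ S) then f z else 0) := Finset.sum_comm
      _ ≤ ∑ i ∈ B, 2 / 5 * W := Finset.sum_le_sum hB
      _ = _ := by rw [Finset.sum_const, nsmul_eq_mul]; ring
  -- Under the weights `f / W` the mean of `K` is at most 2|B|/5, so by Jensen the mean of (2/3)^K
  -- is at least (2/3)^(2|B|/5). Over all sets, (2/3)^K sums to 2^|ι| (5/6)^|B|, as each coordinate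
  -- of `B` contributes 2/3 + 1. With `f ≤ 1` this bounds `W`.
  have hJ := convexOn_exp.map_sum_le (t := Finset.univ) (w := fun z => f z / W)
    (p := fun z => -(c * K z)) (fun z _ => div_nonneg (h0 z) hW0)
    (by rw [← Finset.sum_div]; exact div_self hWpos.ne') (fun _ _ => Set.mem_univ _)
  have hexp : ∀ k : ℕ, Real.exp (-(c * k)) = (2 / 3 : ℝ) ^ k := by
    intro k
    rw [mul_comm, ← mul_neg, Real.exp_nat_mul, Real.exp_neg, Real.exp_log (by norm_num)]
    norm_num
  simp only [smul_eq_mul, hexp] at hJ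
  have hlow : Real.exp (-(c * (2 / 5 * B.card))) ≤
      Real.exp (∑ z, f z / W * -(c * K z)) := by
    apply Real.exp_le_exp.2
    have : ∑ z, f z / W * -(c * K z) = -(c * ((∑ z, f z * K z) / W)) := by
      rw [Finset.sum_div, Finset.mul_sum, ← Finset.sum_neg_distrib]
      refine Finset.sum_congr rfl fun z _ => ?_
      ring
    rw [this]
    have h2 : (∑ z, f z * K z) / W ≤ 2 / 5 * B.card := (div_le_iff₀ hWpos).2 hKsum
    have := mul_le_mul_of_nonneg_left h2 hc.le
    linarith
  have htot : ∑ z : Finset ι, (2 / 3 : ℝ) ^ K z = 2 ^ Fintype.card ι * (5 / 6) ^ B.card := by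
    have h2 : ∀ z : Finset ι, (2 / 3 : ℝ) ^ K z =
        ∏ i, (if i ∈ z then (if i ∈ B then (if i ∈ S then 2 / 3 else 1) else 1)
          else (if i ∈ B then (if i ∈ S then 1 else 2 / 3) else 1)) := by
      intro z
      rw [← Finset.prod_const, Finset.prod_filter,
        ← Finset.prod_subset (Finset.subset_univ B)]
      · refine Finset.prod_congr rfl fun i hi => ?_
        by_cases a : i ∈ z <;> by_cases b : i ∈ S <;> simp [a, b, hi]
      · intro i _ hi
        simp [hi]
    rw [Finset.sum_congr rfl fun z _ => h2 z, sum_prod_ite]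
    have h3 : ∀ i : ι, ((if i ∈ B then (if i ∈ S then 2 / 3 else 1) else 1) +
        (if i ∈ B then (if i ∈ S then 1 else 2 / 3) else 1) : ℝ) =
        2 * (if i ∈ B then 5 / 6 else 1) := by
      intro i
      split_ifs <;> norm_num
    rw [Finset.prod_congr rfl fun i _ => h3 i, Finset.prod_mul_distrib, Finset.prod_const,
      Finset.card_univ, Finset.prod_ite, Finset.prod_const, Finset.prod_const_one, mul_one]
    simp
  have hup : ∑ z, f z / W * (2 / 3 : ℝ) ^ K z ≤
      2 ^ Fintype.card ι * (5 / 6) ^ B.card / W := by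
    rw [← htot, Finset.sum_div]
    refine Finset.sum_le_sum fun z _ => ?_
    rw [div_mul_eq_mul_div]
    have : f z * (2 / 3 : ℝ) ^ K z ≤ 1 * (2 / 3 : ℝ) ^ K z :=
      mul_le_mul_of_nonneg_right (h1 z) (by positivity)
    rw [one_mul] at this
    gcongr
  have hfin := (hlow.trans hJ).trans hup
  rw [le_div_iff₀ hWpos] at hfin
  have hb : biasBase ^ B.card = (5 / 6) ^ B.card * Real.exp (c * (2 / 5 * B.card)) := by
    unfold biasBase
    rw [mul_pow, ← Real.rpow_natCast (_ ^ _), ← Real.rpow_mul (by norm_num),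
      Real.rpow_def_of_pos (by norm_num)]
  rw [hb]
  rw [Real.exp_neg, inv_mul_le_iff₀ (Real.exp_pos _)] at hfin
  linarith

/-- The sum of `f` over the subsets of `T`, up to a factor depending on `T`. -/
def mass (f : Finset ι → ℝ) (T : Finset ι) : ℝ := ∑ z, f (z ∩ T)

/-- The part of `mass f T` coming from the sets that contain `i`. -/
def massWith (f : Finset ι → ℝ) (i : ι) (T : Finset ι) : ℝ :=
  ∑ z, if i ∈ z then f (z ∩ T) else 0

/-- The part of `mass f T` coming from the sets that do not contain `i`. -/
def massWithout (f : Finset ι → ℝ) (i : ι) (T : Finset ι) : ℝ :=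
  ∑ z, if i ∈ z then 0 else f (z ∩ T)

lemma massWith_add_massWithout (f : Finset ι → ℝ) (i : ι) (T : Finset ι) :
    massWith f i T + massWithout f i T = mass f T := by
  unfold massWith massWithout mass
  rw [← Finset.sum_add_distrib]
  refine Finset.sum_congr rfl fun z _ => ?_
  split_ifs <;> simp

/-- Forbidding `i` in the ground set amounts to keeping only the sets that avoid `i`; the factor 2
counts the then irrelevant membership of `i` in `z`. -/
lemma mass_erase (f : Finset ι → ℝ) (i : ι) (T : Finset ι) :
    mass f (T.erase i) = 2 * massWithout f i (insert i T) := by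
  unfold massWithout mass
  rw [← sum_erase (fun z => f (z ∩ insert i T)) i]
  refine Finset.sum_congr rfl fun z _ => ?_
  congr 1
  ext a
  simp only [Finset.mem_inter, Finset.mem_erase, Finset.mem_insert]
  grind

/-- The coordinates that are biased on the sets counted by `mass f T`. -/
noncomputable def biased (f : Finset ι → ℝ) (T : Finset ι) : Finset ι :=
  Finset.univ.filter fun i =>
    massWith f i T < 2 / 5 * mass f T ∨ massWithout f i T < 2 / 5 * mass f T

/-- In `sum_le_biasBase_pow`, `S` collects the coordinates whose presence is the light side; on the
other biased coordinates absence is light. -/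
lemma mass_le_of_biased (f : Finset ι → ℝ) (h0 : ∀ z, 0 ≤ f z) (h1 : ∀ z, f z ≤ 1)
    (T : Finset ι) :
    mass f T ≤ 2 ^ Fintype.card ι * biasBase ^ (biased f T).card := by
  refine sum_le_biasBase_pow (fun z => f (z ∩ T)) (fun z => h0 _) (fun z => h1 _) (biased f T)
    (Finset.univ.filter fun i => massWith f i T < 2 / 5 * mass f T) fun i hi => ?_
  simp only [biased, Finset.mem_filter, Finset.mem_univ, true_and] at hi
  by_cases h : massWith f i T < 2 / 5 * mass f T
  · simp only [Finset.mem_filter, Finset.mem_univ, true_and, h, iff_true]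
    exact h.le
  · have h' := (hi.resolve_left h).le
    simp only [Finset.mem_filter, Finset.mem_univ, true_and, h, iff_false]
    refine le_trans (le_of_eq ?_) h'
    unfold massWithout
    refine Finset.sum_congr rfl fun z _ => ?_
    split_ifs <;> simp_all

section Nonneg

variable {f g : Finset ι → ℝ}

lemma mass_nonneg (h0 : ∀ z, 0 ≤ f z) (T : Finset ι) : 0 ≤ mass f T :=
  Finset.sum_nonneg fun _ _ => h0 _

lemma massWith_nonneg (h0 : ∀ z, 0 ≤ f z) (i : ι) (T : Finset ι) : 0 ≤ massWith f i T :=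
  Finset.sum_nonneg fun z _ => by split_ifs <;> simp [h0]

lemma massWithout_nonneg (h0 : ∀ z, 0 ≤ f z) (i : ι) (T : Finset ι) :
    0 ≤ massWithout f i T :=
  Finset.sum_nonneg fun z _ => by split_ifs <;> simp [h0]

lemma mass_le (h1 : ∀ z, f z ≤ 1) (T : Finset ι) : mass f T ≤ 2 ^ Fintype.card ι := by
  calc mass f T ≤ ∑ _z : Finset ι, (1 : ℝ) := Finset.sum_le_sum fun _ _ => h1 _
    _ = _ := by simp

end Nonneg

/-- The weight of the rectangle `f × g` on the hard distribution of disjoint pairs (not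
normalized). -/
def disjointWeight (f g : Finset ι → ℝ) : ℝ := ∑ T, mass f T * mass g Tᶜ

/-- The weight of the rectangle `f × g` on the hard distribution of pairs with exactly one common
element (not normalized). -/
def meetWeight (f g : Finset ι → ℝ) : ℝ :=
  ∑ i, ∑ T, massWith f i (insert i T) * massWith g i (insert i Tᶜ)

lemma disjointWeight_comm (f g : Finset ι → ℝ) : disjointWeight f g = disjointWeight g f := by
  unfold disjointWeight
  rw [← Equiv.sum_comp (compl_involutive (α := Finset ι)).toPerm]
  refine Finset.sum_congr rfl fun T _ => ?_
  simp [mul_comm]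

/-- The weight of the partitions that are biased on the side of `f`. -/
noncomputable def biasedWeight (f g : Finset ι → ℝ) : ℝ :=
  ∑ i, ∑ T, if i ∈ biased f (insert i T) then mass f (insert i T) * mass g (insert i T)ᶜ else 0

/-- The exponentially small error of the corruption bound. -/
noncomputable def corruptionError (n : ℕ) : ℝ := Real.exp (Real.log biasBase / 280 * n)

/-- The error is `biasBase ^ (n / 280)`, and the base is below 1. -/
lemma biasBase_pow_le (n b : ℕ) (h : (n : ℝ) / 280 ≤ b) :
    biasBase ^ b ≤ corruptionError n := by
  unfold corruptionError
  rw [← Real.exp_log (pow_pos biasBase_pos b), Real.log_pow]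
  apply Real.exp_le_exp.2
  have := Real.log_neg biasBase_pos biasBase_lt_one
  nlinarith

/-- For each `T`, either at most n/280 coordinates are biased, or the mass of `f` is exponentially
small. The factor 2 comes from `sum_insert`; 8^n is the error 4^n summed over the 2^n sets `T`. -/
lemma biasedWeight_le (f g : Finset ι → ℝ) (hf0 : ∀ z, 0 ≤ f z) (hf1 : ∀ z, f z ≤ 1)
    (hg0 : ∀ z, 0 ≤ g z) (hg1 : ∀ z, g z ≤ 1) :
    biasedWeight f g ≤ 2 * Fintype.card ι * (disjointWeight f g / 280 +
      8 ^ Fintype.card ι * corruptionError (Fintype.card ι)) := by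
  set n := Fintype.card ι with hn
  have herr : 0 < corruptionError n := Real.exp_pos _
  have hT : ∀ T : Finset ι, (biased f T).card * (mass f T * mass g Tᶜ) ≤
      n * (mass f T * mass g Tᶜ / 280 + 4 ^ n * corruptionError n) := by
    intro T
    have hF := mass_nonneg hf0 T
    have hG := mass_nonneg hg0 Tᶜ
    have hb : ((biased f T).card : ℝ) ≤ n := by exact_mod_cast Finset.card_le_univ _
    rcases le_total ((biased f T).card : ℝ) ((n : ℝ) / 280) with h | h
    · have := mul_le_mul_of_nonneg_right h (mul_nonneg hF hG)
      have : (0 : ℝ) ≤ n * (4 ^ n * corruptionError n) := by positivity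
      linarith
    · have h1 := (mass_le_of_biased f hf0 hf1 T).trans
        (mul_le_mul_of_nonneg_left (biasBase_pow_le n _ h) (by positivity))
      have h2 := mul_le_mul h1 (mass_le hg1 Tᶜ) hG (by positivity)
      have h3 : (2 : ℝ) ^ n * 2 ^ n = 4 ^ n := by rw [← mul_pow]; norm_num
      have h4 : mass f T * mass g Tᶜ ≤ 4 ^ n * corruptionError n := by
        rw [← h3]; rw [← hn] at h2; linarith
      have h5 := mul_le_mul hb h4 (mul_nonneg hF hG) (by positivity)
      have : (0 : ℝ) ≤ n * (mass f T * mass g Tᶜ / 280) := by positivity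
      linarith
  calc biasedWeight f g
      = ∑ i, 2 * ∑ T, (if i ∈ T then
          (if i ∈ biased f T then mass f T * mass g Tᶜ else 0) else 0) := by
        unfold biasedWeight
        exact Finset.sum_congr rfl fun i _ =>
          sum_insert (fun T => if i ∈ biased f T then mass f T * mass g Tᶜ else 0) i
    _ ≤ ∑ i, 2 * ∑ T, (if i ∈ biased f T then mass f T * mass g Tᶜ else 0) := by
        gcongr with i _ T _
        have := mul_nonneg (mass_nonneg hf0 T) (mass_nonneg hg0 Tᶜ)
        split_ifs <;> simp [this]
    _ = 2 * ∑ T, (biased f T).card * (mass f T * mass g Tᶜ) := by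
        rw [← Finset.mul_sum, Finset.sum_comm]
        congr 1
        refine Finset.sum_congr rfl fun T _ => ?_
        rw [← Finset.sum_filter, Finset.sum_const, nsmul_eq_mul]
        congr 3
        ext; simp
    _ ≤ 2 * ∑ T : Finset ι, n * (mass f T * mass g Tᶜ / 280 + 4 ^ n * corruptionError n) := by
        exact mul_le_mul_of_nonneg_left (Finset.sum_le_sum fun T _ => hT T) zero_le_two
    _ = _ := by
        rw [← Finset.mul_sum, Finset.sum_add_distrib, ← Finset.sum_div, Finset.sum_const,
          Finset.card_univ, Fintype.card_finset, ← hn, nsmul_eq_mul]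
        have : (8 : ℝ) ^ n = 2 ^ n * 4 ^ n := by rw [← mul_pow]; norm_num
        rw [this]
        unfold disjointWeight
        push_cast
        ring

/-- The corruption inequality for a single coordinate. -/
lemma corruption_aux {F₀ F₁ G₀ G₁ : ℝ} (hF₀ : 0 ≤ F₀) (hF₁ : 0 ≤ F₁) (hG₀ : 0 ≤ G₀)
    (hG₁ : 0 ≤ G₁) (p q : Prop) [Decidable p] [Decidable q]
    (hp : ¬ p → 2 / 5 * (F₁ + F₀) ≤ F₁ ∧ 2 / 5 * (F₁ + F₀) ≤ F₀)
    (hq : ¬ q → 2 / 5 * (G₁ + G₀) ≤ G₁ ∧ 2 / 5 * (G₁ + G₀) ≤ G₀) :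
    1 / 15 * ((F₁ + F₀) * (2 * G₀) + 2 * F₀ * (G₁ + G₀) -
      7 / 2 * ((if p then (F₁ + F₀) * (2 * G₀) else 0) +
        (if q then 2 * F₀ * (G₁ + G₀) else 0))) ≤ F₁ * G₁ := by
  have a := mul_nonneg hF₀ hG₀
  have b := mul_nonneg hF₀ hG₁
  have c := mul_nonneg hF₁ hG₀
  have d := mul_nonneg hF₁ hG₁
  -- If neither side is biased, `F₀ ≤ 3/2 F₁` and `G₀ ≤ 3/2 G₁` bound the two products by (3 + 9 +
  -- 3) `F₁ * G₁`, whence 1/15. Otherwise 7/2 = 1 + 5/2 makes the left side nonpositive: 1 cancels a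
  -- biased product, and 5/2 of it dominates the other product when that one is unbiased.
  by_cases h : p <;> by_cases h' : q <;> simp only [h, h', if_true, if_false]
  · linarith
  · obtain ⟨-, h2⟩ := hq h'
    have := mul_le_mul_of_nonneg_left h2 hF₀
    linarith
  · obtain ⟨-, h2⟩ := hp h
    have := mul_le_mul_of_nonneg_right h2 hG₀
    linarith
  · obtain ⟨h1, h2⟩ := hp h
    obtain ⟨h3, h4⟩ := hq h'
    have e1 : F₀ ≤ 3 / 2 * F₁ := by linarith
    have e2 : G₀ ≤ 3 / 2 * G₁ := by linarith
    have := mul_le_mul_of_nonneg_right e1 hG₁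
    have := mul_le_mul_of_nonneg_left e2 hF₁
    have := mul_le_mul e1 e2 hG₀ (by positivity)
    linarith

/-- Fix `i` and `T`, and offer `i` to both sides. Withdrawing it from one side or the other gives
two partitions of the disjoint distribution, so `corruption_aux` compares the sums term by term. The
biased terms cost 7/2 · 2 · 2n/280 = n/20 of the disjoint weight, leaving (2 - 1/20)/15 = 13/100. -/
theorem corruption_bound (f g : Finset ι → ℝ) (hf0 : ∀ z, 0 ≤ f z) (hf1 : ∀ z, f z ≤ 1)
    (hg0 : ∀ z, 0 ≤ g z) (hg1 : ∀ z, g z ≤ 1) :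
    (Fintype.card ι : ℝ) * (13 / 100 * disjointWeight f g -
      14 / 15 * (8 ^ Fintype.card ι * corruptionError (Fintype.card ι))) ≤ meetWeight f g := by
  have hx := biasedWeight_le f g hf0 hf1 hg0 hg1
  have hy := biasedWeight_le g f hg0 hg1 hf0 hf1
  rw [disjointWeight_comm g f] at hy
  have hc : ∀ (i : ι) (T : Finset ι), (insert i T)ᶜ = Tᶜ.erase i := by
    intro i T; ext; simp
  have hc' : ∀ (i : ι) (T : Finset ι), (T.erase i)ᶜ = insert i Tᶜ := by
    intro i T; ext; simp
  have hyb : biasedWeight g f = ∑ i, ∑ T : Finset ι,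
      if i ∈ biased g (insert i Tᶜ) then mass f (T.erase i) * mass g (insert i Tᶜ) else 0 := by
    unfold biasedWeight
    refine Finset.sum_congr rfl fun i _ => ?_
    rw [← Equiv.sum_comp (compl_involutive (α := Finset ι)).toPerm]
    refine Finset.sum_congr rfl fun T _ => ?_
    simp [hc, mul_comm]
  have hw : ∑ i : ι, ∑ T : Finset ι, (mass f (insert i T) * mass g (insert i T)ᶜ +
      mass f (T.erase i) * mass g (T.erase i)ᶜ) =
      2 * Fintype.card ι * disjointWeight f g := by
    rw [Finset.sum_congr rfl fun i _ =>
      sum_insert_add_erase (fun T => mass f T * mass g Tᶜ) i, Finset.sum_const,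
      Finset.card_univ, nsmul_eq_mul]
    unfold disjointWeight
    ring
  have hmain : 1 / 15 * (2 * Fintype.card ι * disjointWeight f g -
      7 / 2 * (biasedWeight f g + biasedWeight g f)) ≤ meetWeight f g := by
    rw [hyb, ← hw]
    unfold biasedWeight meetWeight
    simp only [← Finset.sum_add_distrib, ← Finset.sum_sub_distrib, Finset.mul_sum]
    refine Finset.sum_le_sum fun i _ => Finset.sum_le_sum fun T _ => ?_
    have key := corruption_aux (massWithout_nonneg hf0 i (insert i T))
      (massWith_nonneg hf0 i (insert i T)) (massWithout_nonneg hg0 i (insert i Tᶜ))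
      (massWith_nonneg hg0 i (insert i Tᶜ)) (i ∈ biased f (insert i T))
      (i ∈ biased g (insert i Tᶜ))
      (by
        intro h
        simp only [biased, Finset.mem_filter, Finset.mem_univ, true_and, not_or, not_lt] at h
        rwa [massWith_add_massWithout])
      (by
        intro h
        simp only [biased, Finset.mem_filter, Finset.mem_univ, true_and, not_or, not_lt] at h
        rwa [massWith_add_massWithout])
    simp only [massWith_add_massWithout, ← mass_erase] at key
    simp only [hc, hc']
    exact key
  linarith

end Corruption

/-! ## Costs of centers on the line -/

section Cost

variable {n k : ℕ}

attribute [local instance] Matrix.frobeniusNormedAddCommGroup in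
lemma frobSq_eq {d : ℕ} (M : Matrix (Fin n) (Fin d) ℝ) : frobSq M = ∑ i, ∑ j, M i j ^ 2 := by
  unfold frobSq
  rw [Matrix.frobenius_norm_def, ← Real.rpow_natCast, ← Real.rpow_mul (by positivity)]
  norm_num

lemma frobSq_nonneg {d : ℕ} (M : Matrix (Fin n) (Fin d) ℝ) : 0 ≤ frobSq M := sq_nonneg _

lemma frobSq_assignment (A : Matrix (Fin n) (Fin 1) ℝ) (D : Matrix (Fin k) (Fin 1) ℝ)
    (X : Matrix (Fin n) (Fin k) ℝ) (c : Fin n → Fin k) (hX : ∀ i, X i = Pi.single (c i) 1) :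
    frobSq (X * D - A) = ∑ i, (D (c i) 0 - A i 0) ^ 2 := by
  rw [frobSq_eq]
  refine Finset.sum_congr rfl fun i _ => ?_
  rw [Fin.sum_univ_one, Matrix.sub_apply, Matrix.mul_apply]
  simp [hX, Pi.single_apply]

lemma exists_assignment (c : Fin n → Fin k) :
    ∃ X : assignments n k, ∀ i, X.1 i = Pi.single (c i) 1 :=
  ⟨⟨fun i => Pi.single (c i) 1, fun i => ⟨c i, rfl⟩⟩, fun _ => rfl⟩

lemma centersCost_nonneg (A : Matrix (Fin n) (Fin 1) ℝ) (D : Matrix (Fin k) (Fin 1) ℝ) :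
    0 ≤ centersCost A D :=
  Real.iInf_nonneg fun _ => frobSq_nonneg _

lemma optCost_le (A : Matrix (Fin n) (Fin 1) ℝ) (D : Matrix (Fin k) (Fin 1) ℝ)
    (c : Fin n → Fin k) : optCost k A ≤ ∑ i, (D (c i) 0 - A i 0) ^ 2 := by
  obtain ⟨X, hX⟩ := exists_assignment c
  rw [← frobSq_assignment A D X.1 c hX]
  exact ciInf_le (f := fun p : assignments n k × Matrix (Fin k) (Fin 1) ℝ =>
    frobSq (p.1.1 * p.2 - A)) ⟨0, by rintro _ ⟨p, rfl⟩; exact frobSq_nonneg _⟩ (X, D)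

instance finite_assignments : Finite (assignments n k) := by
  choose c hc using fun X : assignments n k => X.2
  refine Finite.of_injective c fun X Y h => Subtype.ext (funext fun i => ?_)
  rw [hc X, hc Y, h]

/-- There are finitely many assignments, and `k ≠ 0` provides one, so the infimum is attained. -/
lemma exists_centersCost_eq [NeZero k] (A : Matrix (Fin n) (Fin 1) ℝ)
    (D : Matrix (Fin k) (Fin 1) ℝ) :
    ∃ c : Fin n → Fin k, centersCost A D = ∑ i, (D (c i) 0 - A i 0) ^ 2 := by
  have : Nonempty (assignments n k) := ⟨(exists_assignment fun _ => 0).choose⟩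
  obtain ⟨X, hX⟩ := exists_eq_ciInf_of_finite (f := fun X : assignments n k =>
    frobSq (X.1 * D - A))
  choose c hc using X.2
  exact ⟨c, by rw [← frobSq_assignment A D X.1 c hc]; exact hX.symm⟩

end Cost

/-! ## The stream of a pair of sets -/

section Streams

variable {n d : ℕ}

lemma foldl_update (σ : List (Update n d)) (A : Matrix (Fin n) (Fin d) ℝ) (i : Fin n)
    (j : Fin d) :
    σ.foldl (fun A x => A + Matrix.single x.row x.col x.val) A i j =
      A i j + (σ.map fun x => if x.row = i ∧ x.col = j then x.val else 0).sum := by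
  induction σ generalizing A with
  | nil => simp
  | cons x σ ih =>
    rw [List.foldl_cons, ih, List.map_cons, List.sum_cons, Matrix.add_apply,
      Matrix.single_apply]
    ring

lemma streamMatrix_apply (σ : List (Update n d)) (i : Fin n) (j : Fin d) :
    streamMatrix σ i j = (σ.map fun x => if x.row = i ∧ x.col = j then x.val else 0).sum := by
  unfold streamMatrix
  rw [foldl_update]
  simp

lemma streamMatrix_append (σ τ : List (Update n d)) (i : Fin n) (j : Fin d) :
    streamMatrix (σ ++ τ) i j = streamMatrix σ i j + streamMatrix τ i j := by
  simp [streamMatrix_apply]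

lemma exists_nat_streamMatrix (σ : List (Update n d)) (h : ∀ x ∈ σ, ∃ a : ℕ, x.val = a)
    (i : Fin n) (j : Fin d) : ∃ a : ℕ, streamMatrix σ i j = a := by
  rw [streamMatrix_apply]
  induction σ with
  | nil => exact ⟨0, by simp⟩
  | cons x σ ih =>
    obtain ⟨a, ha⟩ := ih fun y hy => h y (List.mem_cons_of_mem _ hy)
    obtain ⟨b, hb⟩ := h x List.mem_cons_self
    rw [List.map_cons, List.sum_cons, ha, hb]
    split_ifs
    · exact ⟨b + a, by push_cast; ring⟩
    · exact ⟨a, by ring⟩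

/-- Entries only grow under nonnegative updates, so the final matrix bounds all earlier ones. -/
lemma integerBounded_of_nat (σ : List (Update n d)) (h : ∀ x ∈ σ, ∃ a : ℕ, x.val = a) (B : ℕ)
    (hB : ∀ i j, streamMatrix σ i j ≤ B) : IntegerBounded B σ := by
  rintro τ ⟨ρ, rfl⟩ i j
  obtain ⟨a, ha⟩ := exists_nat_streamMatrix τ (fun x hx => h x (by simp [hx])) i j
  obtain ⟨b, hb⟩ := exists_nat_streamMatrix ρ (fun x hx => h x (by simp [hx])) i j
  have := hB i j
  rw [streamMatrix_append, ha, hb] at this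
  refine ⟨a, ?_, by simpa using ha⟩
  rw [abs_of_nonneg (by positivity)]
  have : a + b ≤ B := by exact_mod_cast this
  omega

variable {N : ℕ}

/-- The updates that add the indicator vector of `x` to the first `N` entries. -/
def indicatorUpdates (x : Finset (Fin N)) : List (Update (N + 3) 1) :=
  (List.finRange N).map fun i => ⟨Fin.castAdd 3 i, 0, if i ∈ x then 1 else 0⟩

/-- The updates that set the last two entries to `1` and `3`. -/
def paddingUpdates (N : ℕ) : List (Update (N + 3) 1) :=
  [⟨Fin.natAdd N 1, 0, 1⟩, ⟨Fin.natAdd N 2, 0, 3⟩]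

/-- The part of the stream that depends on the first set. -/
def firstPart (x : Finset (Fin N)) : List (Update (N + 3) 1) :=
  paddingUpdates N ++ indicatorUpdates x

/-- The stream of a pair of sets. -/
def pairStream (x y : Finset (Fin N)) : List (Update (N + 3) 1) :=
  firstPart x ++ indicatorUpdates y

lemma length_firstPart (x : Finset (Fin N)) : (firstPart x).length = N + 2 := by
  simp [firstPart, paddingUpdates, indicatorUpdates]

lemma length_pairStream (x y : Finset (Fin N)) : (pairStream x y).length = 2 * N + 2 := by
  rw [pairStream, List.length_append, length_firstPart]
  simp [indicatorUpdates]; ring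

lemma streamMatrix_indicator_castAdd (x : Finset (Fin N)) (i : Fin N) (j : Fin 1) :
    streamMatrix (indicatorUpdates x) (Fin.castAdd 3 i) j = if i ∈ x then 1 else 0 := by
  rw [streamMatrix_apply, indicatorUpdates, List.map_map, ← Fin.sum_univ_def,
    Finset.sum_eq_single i]
  · simp [Subsingleton.elim j 0]
  · intro b _ hb
    simp [hb]
  · simp

lemma streamMatrix_indicator_natAdd (x : Finset (Fin N)) (l : Fin 3) (j : Fin 1) :
    streamMatrix (indicatorUpdates x) (Fin.natAdd N l) j = 0 := by
  rw [streamMatrix_apply, indicatorUpdates, List.map_map, ← Fin.sum_univ_def]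
  refine Finset.sum_eq_zero fun b _ => ?_
  have : Fin.castAdd 3 b ≠ Fin.natAdd N l := by
    intro h
    have := congrArg Fin.val h
    simp at this
    omega
  simp [this]

lemma pairStream_castAdd (x y : Finset (Fin N)) (i : Fin N) (j : Fin 1) :
    streamMatrix (pairStream x y) (Fin.castAdd 3 i) j =
      (if i ∈ x then 1 else 0) + (if i ∈ y then 1 else 0) := by
  have h : ∀ l : Fin 3, Fin.natAdd N l ≠ Fin.castAdd 3 i := by
    intro l h
    have := congrArg Fin.val h
    simp at this
    omega
  rw [pairStream, firstPart, streamMatrix_append, streamMatrix_append,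
    streamMatrix_indicator_castAdd, streamMatrix_indicator_castAdd]
  simp [paddingUpdates, streamMatrix_apply, h]

lemma pairStream_natAdd (x y : Finset (Fin N)) (l : Fin 3) (j : Fin 1) :
    streamMatrix (pairStream x y) (Fin.natAdd N l) j = ![0, 1, 3] l := by
  rw [pairStream, firstPart, streamMatrix_append, streamMatrix_append,
    streamMatrix_indicator_natAdd, streamMatrix_indicator_natAdd]
  have : j = 0 := Subsingleton.elim _ _
  fin_cases l <;> simp [paddingUpdates, streamMatrix_apply, this]

lemma integerBounded_pairStream (x y : Finset (Fin N)) : IntegerBounded 3 (pairStream x y) := by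
  have hind : ∀ z : Finset (Fin N), ∀ u ∈ indicatorUpdates z, ∃ a : ℕ, u.val = a := by
    intro z u hu
    obtain ⟨i, -, rfl⟩ := List.mem_map.1 hu
    exact ⟨if i ∈ z then 1 else 0, by simp⟩
  refine integerBounded_of_nat _ ?_ 3 ?_
  · intro u hu
    simp only [pairStream, firstPart, List.mem_append] at hu
    rcases hu with (hu | hu) | hu
    · simp only [paddingUpdates, List.mem_cons, List.not_mem_nil, or_false] at hu
      rcases hu with rfl | rfl
      · exact ⟨1, by simp⟩
      · exact ⟨3, by simp⟩
    · exact hind x u hu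
    · exact hind y u hu
  · intro i j
    refine Fin.addCases (fun i => ?_) (fun l => ?_) i
    · rw [pairStream_castAdd]
      split_ifs <;> norm_num
    · rw [pairStream_natAdd]
      fin_cases l <;> simp

/-- All of `0`, `1`, `3` are among the centers. -/
def HasPaddingCenters (D : Matrix (Fin 3) (Fin 1) ℝ) : Prop :=
  ∀ l : Fin 3, ∃ m, D m 0 = ![0, 1, 3] l

lemma hasPaddingCenters_of_disjoint (x y : Finset (Fin N)) (hxy : Disjoint x y)
    (D : Matrix (Fin 3) (Fin 1) ℝ) (hD : BetterThanTwo (streamMatrix (pairStream x y)) D) :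
    HasPaddingCenters D := by
  have hopt : optCost 3 (streamMatrix (pairStream x y)) ≤ 0 := by
    refine (optCost_le _ (fun l _ => ![0, 1, 3] l)
      (Fin.addCases (fun i => if i ∈ x ∨ i ∈ y then 1 else 0) id)).trans (le_of_eq ?_)
    rw [Fin.sum_univ_add]
    simp only [Fin.addCases_left, Fin.addCases_right, pairStream_castAdd, pairStream_natAdd, id,
      sub_self]
    rw [Finset.sum_eq_zero, Finset.sum_eq_zero, add_zero]
    · simp
    · intro i _
      have : i ∈ x → i ∉ y := fun h => Finset.disjoint_left.1 hxy h
      by_cases h1 : i ∈ x <;> by_cases h2 : i ∈ y <;> simp_all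
  have h0 : centersCost (streamMatrix (pairStream x y)) D = 0 := by
    rcases hD with h | h
    · have := centersCost_nonneg (streamMatrix (pairStream x y)) D
      linarith
    · exact h
  obtain ⟨c, hc⟩ := exists_centersCost_eq (streamMatrix (pairStream x y)) D
  rw [h0, eq_comm, Finset.sum_eq_zero_iff_of_nonneg fun _ _ => sq_nonneg _] at hc
  intro l
  refine ⟨c (Fin.natAdd N l), ?_⟩
  have := hc (Fin.natAdd N l) (Finset.mem_univ _)
  rw [pow_eq_zero_iff two_ne_zero, sub_eq_zero] at this
  rw [this, pairStream_natAdd]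

/-- Three distinct values use up all three centers. -/
lemma HasPaddingCenters.eq {D : Matrix (Fin 3) (Fin 1) ℝ} (hD : HasPaddingCenters D)
    (m : Fin 3) : D m 0 = 0 ∨ D m 0 = 1 ∨ D m 0 = 3 := by
  choose g hg using hD
  have hinj : Function.Injective g := by
    intro a b h
    have : (![0, 1, 3] a : ℝ) = ![0, 1, 3] b := by rw [← hg, ← hg, h]
    fin_cases a <;> fin_cases b <;> simp_all
  obtain ⟨l, rfl⟩ := Finite.surjective_of_injective hinj m
  rw [hg]
  fin_cases l <;> simp

lemma not_betterThanTwo_of_meet (x y : Finset (Fin N)) (i₀ : Fin N) (hxy : x ∩ y = {i₀})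
    (D : Matrix (Fin 3) (Fin 1) ℝ) (hD : HasPaddingCenters D) :
    ¬ BetterThanTwo (streamMatrix (pairStream x y)) D := by
  have hmem : ∀ i, i ∈ x ∧ i ∈ y ↔ i = i₀ := by
    intro i
    rw [← Finset.mem_inter, hxy, Finset.mem_singleton]
  have hopt : optCost 3 (streamMatrix (pairStream x y)) ≤ 1 / 2 := by
    -- The entries 2 and 3 share the center 5/2, at cost 1/4 + 1/4.
    refine (optCost_le _ (fun l _ => ![0, 1, 5 / 2] l)
      (Fin.addCases (fun i => if i ∈ x ∧ i ∈ y then 2 else if i ∈ x ∨ i ∈ y then 1 else 0)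
        id)).trans (le_of_eq ?_)
    rw [Fin.sum_univ_add]
    simp only [Fin.addCases_left, Fin.addCases_right, pairStream_castAdd, pairStream_natAdd, id]
    rw [Finset.sum_eq_single i₀, Fin.sum_univ_three]
    · have := (hmem i₀).2 rfl
      simp [this.1, this.2]
      norm_num
    · intro i _ hi
      have := mt (hmem i).1 hi
      by_cases h1 : i ∈ x <;> by_cases h2 : i ∈ y <;> simp_all
    · simp
  have hcost : 1 ≤ centersCost (streamMatrix (pairStream x y)) D := by
    obtain ⟨c, hc⟩ := exists_centersCost_eq (streamMatrix (pairStream x y)) D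
    rw [hc]
    refine le_trans ?_ (Finset.single_le_sum (fun i _ => sq_nonneg _)
      (Finset.mem_univ (Fin.castAdd 3 i₀)))
    obtain ⟨h1, h2⟩ := (hmem i₀).2 rfl
    rw [pairStream_castAdd, if_pos h1, if_pos h2]
    rcases hD.eq (c (Fin.castAdd 3 i₀)) with h | h | h <;> rw [h] <;> norm_num
  rintro (h | h) <;> linarith

end Streams

/-! ## Sums of rectangles -/

section Rectangles

variable {ι : Type*}

/-- `h` is a sum of `K` rectangles. -/
def IsRectangleSum (K : ℕ) (h : Finset ι → Finset ι → ℝ) : Prop :=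
  ∃ (κ : Type) (_ : Fintype κ) (f g : κ → Finset ι → ℝ), Fintype.card κ = K ∧
    (∀ k z, 0 ≤ f k z ∧ f k z ≤ 1) ∧ (∀ k z, 0 ≤ g k z ∧ g k z ≤ 1) ∧
    ∀ x y, h x y = ∑ k, f k x * g k y

lemma IsRectangleSum.const {c : ℝ} (h0 : 0 ≤ c) (h1 : c ≤ 1) :
    IsRectangleSum 1 fun _ _ : Finset ι => c :=
  ⟨Unit, inferInstance, fun _ _ => c, fun _ _ => 1, rfl, fun _ _ => ⟨h0, h1⟩,
    fun _ _ => ⟨zero_le_one, le_rfl⟩, fun _ _ => by simp⟩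

lemma IsRectangleSum.mul {K : ℕ} {h : Finset ι → Finset ι → ℝ} (hh : IsRectangleSum K h)
    (f g : Finset ι → ℝ) (hf : ∀ z, 0 ≤ f z ∧ f z ≤ 1) (hg : ∀ z, 0 ≤ g z ∧ g z ≤ 1) :
    IsRectangleSum K fun x y => h x y * (f x * g y) := by
  obtain ⟨κ, _, f', g', hK, hf', hg', hs⟩ := hh
  refine ⟨κ, inferInstance, fun k z => f' k z * f z, fun k z => g' k z * g z, hK,
    fun k z => ⟨mul_nonneg (hf' k z).1 (hf z).1, mul_le_one₀ (hf' k z).2 (hf z).1 (hf z).2⟩,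
    fun k z => ⟨mul_nonneg (hg' k z).1 (hg z).1, mul_le_one₀ (hg' k z).2 (hg z).1 (hg z).2⟩,
    fun x y => ?_⟩
  beta_reduce
  rw [hs, Finset.sum_mul]
  exact Finset.sum_congr rfl fun k _ => by ring

lemma IsRectangleSum.sum {K : ℕ} {α : Type} [Fintype α] {h : α → Finset ι → Finset ι → ℝ}
    (hh : ∀ a, IsRectangleSum K (h a)) :
    IsRectangleSum (Fintype.card α * K) fun x y => ∑ a, h a x y := by
  choose κ _ f g hK hf hg hs using hh
  refine ⟨Σ a, κ a, inferInstance, fun k => f k.1 k.2, fun k => g k.1 k.2, ?_,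
    fun k => hf k.1 k.2, fun k => hg k.1 k.2, fun x y => ?_⟩
  · simp [hK]
  · rw [Fintype.sum_sigma]
    exact Finset.sum_congr rfl fun a _ => hs a x y

variable [Fintype ι] [DecidableEq ι]

/-- The sum of `h` over the hard distribution of disjoint pairs. -/
def disjointSum (h : Finset ι → Finset ι → ℝ) : ℝ :=
  ∑ p : Finset ι × Finset ι × Finset ι, h (p.2.1 ∩ p.1) (p.2.2 ∩ p.1ᶜ)

/-- The indices of the hard distribution of pairs with one common element. -/
def meetIndex (ι : Type*) [Fintype ι] [DecidableEq ι] :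
    Finset (ι × Finset ι × Finset ι × Finset ι) :=
  Finset.univ.filter fun q => q.1 ∈ q.2.2.1 ∧ q.1 ∈ q.2.2.2

/-- The sum of `h` over the hard distribution of pairs with one common element. -/
def meetSum (h : Finset ι → Finset ι → ℝ) : ℝ :=
  ∑ q ∈ meetIndex ι, h (q.2.2.1 ∩ insert q.1 q.2.1) (q.2.2.2 ∩ insert q.1 q.2.1ᶜ)

lemma disjointSum_rectangle (f g : Finset ι → ℝ) :
    disjointSum (fun x y => f x * g y) = disjointWeight f g := by
  unfold disjointSum disjointWeight mass
  simp only [Fintype.sum_prod_type, Finset.sum_mul_sum]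

lemma meetSum_rectangle (f g : Finset ι → ℝ) :
    meetSum (fun x y => f x * g y) = meetWeight f g := by
  unfold meetSum meetIndex meetWeight massWith
  rw [Finset.sum_filter]
  simp only [Fintype.sum_prod_type, Finset.sum_mul_sum]
  refine Finset.sum_congr rfl fun i _ => Finset.sum_congr rfl fun T _ =>
    Finset.sum_congr rfl fun z _ => Finset.sum_congr rfl fun w _ => ?_
  by_cases h : i ∈ z <;> by_cases h' : i ∈ w <;> simp [h, h']

lemma card_meetIndex : ((meetIndex ι).card : ℝ) = Fintype.card ι * 8 ^ Fintype.card ι / 4 := by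
  have h1 : ((meetIndex ι).card : ℝ) = meetSum (ι := ι) (fun _ _ => 1 * 1) := by
    simp [meetSum]
  have h2 : ∀ (i : ι) (T : Finset ι), massWith (fun _ => 1) i T = 2 ^ Fintype.card ι / 2 := by
    intro i T
    have := sum_insert (fun _ => (1 : ℝ)) i
    rw [Finset.sum_const, Finset.card_univ, Fintype.card_finset] at this
    simp only [nsmul_eq_mul, mul_one, Nat.cast_pow, Nat.cast_ofNat] at this
    unfold massWith
    linarith
  rw [h1, meetSum_rectangle (fun _ => 1) (fun _ => 1), meetWeight]
  simp only [h2, Finset.sum_const, Finset.card_univ, Fintype.card_finset, nsmul_eq_mul]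
  have : (8 : ℝ) ^ Fintype.card ι =
      2 ^ Fintype.card ι * 2 ^ Fintype.card ι * 2 ^ Fintype.card ι := by
    rw [← mul_pow, ← mul_pow]; norm_num
  rw [this]
  push_cast
  ring

lemma IsRectangleSum.corruption {K : ℕ} {h : Finset ι → Finset ι → ℝ}
    (hh : IsRectangleSum K h) :
    (Fintype.card ι : ℝ) * (13 / 100 * disjointSum h -
      K * (14 / 15 * (8 ^ Fintype.card ι * corruptionError (Fintype.card ι)))) ≤ meetSum h := by
  obtain ⟨κ, _, f, g, rfl, hf, hg, hs⟩ := hh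
  have hd : disjointSum h = ∑ k, disjointWeight (f k) (g k) := by
    simp only [← disjointSum_rectangle, disjointSum, hs]
    exact Finset.sum_comm
  have hm : meetSum h = ∑ k, meetWeight (f k) (g k) := by
    simp only [← meetSum_rectangle, meetSum, hs]
    exact Finset.sum_comm
  have := Finset.sum_le_sum fun k (_ : k ∈ Finset.univ) =>
    corruption_bound (f k) (g k) (fun z => (hf k z).1) (fun z => (hf k z).2)
      (fun z => (hg k z).1) (fun z => (hg k z).2)
  rw [← Finset.mul_sum, Finset.sum_sub_distrib, ← Finset.mul_sum, Finset.sum_const,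
    Finset.card_univ, nsmul_eq_mul] at this
  rwa [hd, hm]

end Rectangles

/-! ## From streaming algorithms to rectangles -/

namespace StreamingAlgorithm

variable {Ω : Type u} [MeasurableSpace Ω]

/-! ### Composition and measurability of passes -/

section Read

variable {n d k M : ℕ}

lemma readFrom_append (alg : StreamingAlgorithm Ω n d k M) (ω : Ω) (p t : ℕ)
    (σ τ : List (Update n d)) (m : Memory M) :
    alg.readFrom ω p t (σ ++ τ) m =
      alg.readFrom ω p (t + σ.length) τ (alg.readFrom ω p t σ m) := by
  induction σ generalizing t m with
  | nil => rfl
  | cons x σ ih =>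
    rw [List.cons_append, readFrom, ih, readFrom, List.length_cons, add_right_comm, add_assoc]

/-- The memory is finite, so separate measurability in `ω` gives joint measurability. -/
lemma measurable_apply_memory {β : Type*} [MeasurableSpace β] (F : Ω → Memory M → β)
    (hF : ∀ m, Measurable fun ω => F ω m) (f : Ω → Memory M) (hf : Measurable f) :
    Measurable fun ω => F ω (f ω) :=
  (measurable_from_prod_countable_left (f := fun q : Ω × Memory M => F q.1 q.2) hF).comp
    (measurable_id.prodMk hf)

lemma measurable_readFrom (alg : StreamingAlgorithm Ω n d k M) (p t : ℕ)
    (σ : List (Update n d)) (f : Ω → Memory M) (hf : Measurable f) :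
    Measurable fun ω => alg.readFrom ω p t σ (f ω) := by
  induction σ generalizing t f with
  | nil => exact hf
  | cons x σ ih =>
    exact ih (t + 1) (fun ω => alg.step ω p t (f ω) x)
      (measurable_apply_memory (fun ω m => alg.step ω p t m x)
        (fun m => alg.measurable_step p t m x) f hf)

lemma measurable_memoryAfter (alg : StreamingAlgorithm Ω n d k M) (σ : List (Update n d))
    (r : ℕ) : Measurable fun ω => alg.memoryAfter ω σ r := by
  induction r with
  | zero => exact alg.measurable_init
  | succ r ih => exact alg.measurable_readFrom r 0 σ _ ih

lemma measurable_result (alg : StreamingAlgorithm Ω n d k M) (r : ℕ) (σ : List (Update n d))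
    (i : Fin k) (j : Fin d) : Measurable fun ω => alg.result r ω σ i j :=
  measurable_apply_memory (fun ω m => alg.output ω σ.length m i j)
    (fun m => alg.measurable_output _ m i j) _ (alg.measurable_memoryAfter σ r)

end Read

/-! ### Acceptance as a sum of rectangles -/

variable {N M : ℕ} (alg : StreamingAlgorithm Ω (N + 3) 1 3 M)

open Classical in
-- Split a pass by its memory at the start and after `firstPart`. Given these two, the first half of
-- the pass involves only `x` and the second only `y`. All first parts have length `N + 2`, so the
-- clock tells the second half nothing about `x`.
lemma isRectangleSum_memoryAfter (ω : Ω) (r : ℕ) (m : Memory M) :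
    IsRectangleSum ((2 ^ M * 2 ^ M) ^ r) fun x y : Finset (Fin N) =>
      if alg.memoryAfter ω (pairStream x y) r = m then (1 : ℝ) else 0 := by
  induction r generalizing m with
  | zero =>
    refine IsRectangleSum.const (c := if alg.init ω = m then 1 else 0) ?_ ?_ <;>
      split_ifs <;> norm_num
  | succ r ih =>
    have hs := IsRectangleSum.sum fun q : Memory M × Memory M =>
      (ih q.1).mul (fun x => if alg.readFrom ω r 0 (firstPart x) q.1 = q.2 then 1 else 0)
        (fun y => if alg.readFrom ω r (N + 2) (indicatorUpdates y) q.2 = m then 1 else 0)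
        (fun z => by split_ifs <;> norm_num) (fun z => by split_ifs <;> norm_num)
    rw [Fintype.card_prod, Fintype.card_fun, Fintype.card_bool, Fintype.card_fin,
      ← pow_succ'] at hs
    convert hs using 3 with x y
    rw [memoryAfter, Finset.sum_eq_single (alg.memoryAfter ω (pairStream x y) r,
      alg.readFrom ω r 0 (firstPart x) (alg.memoryAfter ω (pairStream x y) r))]
    · rw [pairStream, readFrom_append, length_firstPart, zero_add]
      simp
    · rintro ⟨a, b⟩ - hab
      by_cases h : alg.memoryAfter ω (pairStream x y) r = a
      · subst h
        have : alg.readFrom ω r 0 (firstPart x) (alg.memoryAfter ω (pairStream x y) r) ≠ b :=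
          fun h => hab (by rw [h])
        simp [this]
      · simp [h]
    · simp

open Classical in
/-- The indicator of the event that the output of the algorithm contains all of `0`, `1`, `3`. -/
noncomputable def accept (r : ℕ) (ω : Ω) (x y : Finset (Fin N)) : ℝ :=
  if HasPaddingCenters (alg.result r ω (pairStream x y)) then 1 else 0

open Classical in
-- The extra factor `2 ^ M` sums over the final memory, which determines the output because all
-- streams have the same length.
lemma isRectangleSum_accept (r : ℕ) (ω : Ω) :
    IsRectangleSum (2 ^ M * (2 ^ M * 2 ^ M) ^ r) (alg.accept r ω) := by
  have hs := IsRectangleSum.sum fun m : Memory M =>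
    (alg.isRectangleSum_memoryAfter ω r m).mul
      (fun _ => if HasPaddingCenters (alg.output ω (2 * N + 2) m) then 1 else 0) (fun _ => 1)
      (fun z => by split_ifs <;> norm_num) (fun z => by norm_num)
  rw [Fintype.card_fun, Fintype.card_bool, Fintype.card_fin] at hs
  convert hs using 3 with x y
  rw [Finset.sum_eq_single (alg.memoryAfter ω (pairStream x y) r)]
  · simp [accept, result, length_pairStream]
  · intro b _ hb
    simp [hb.symm]
  · simp

lemma measurableSet_accept (r : ℕ) (x y : Finset (Fin N)) :
    MeasurableSet {ω | HasPaddingCenters (alg.result r ω (pairStream x y))} := by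
  unfold HasPaddingCenters
  simp only [Set.ofPred_forall, Set.ofPred_exists]
  exact MeasurableSet.iInter fun l => MeasurableSet.iUnion fun m =>
    measurableSet_eq_fun (alg.measurable_result r _ m 0) measurable_const

lemma accept_eq_indicator (r : ℕ) (x y : Finset (Fin N)) :
    (fun ω => alg.accept r ω x y) =
      {ω | HasPaddingCenters (alg.result r ω (pairStream x y))}.indicator 1 := by
  ext ω
  by_cases h : HasPaddingCenters (alg.result r ω (pairStream x y)) <;>
    simp [accept, Set.indicator, h]

/-! ### Acceptance probabilities and averaging over the coins -/

variable (P : Measure Ω)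

lemma integral_accept (r : ℕ) (x y : Finset (Fin N)) :
    ∫ ω, alg.accept r ω x y ∂P =
      P.real {ω | HasPaddingCenters (alg.result r ω (pairStream x y))} := by
  rw [accept_eq_indicator, integral_indicator_one (alg.measurableSet_accept r x y)]

variable [IsProbabilityMeasure P]

lemma integrable_accept (r : ℕ) (x y : Finset (Fin N)) :
    Integrable (fun ω => alg.accept r ω x y) P := by
  rw [accept_eq_indicator]
  exact (integrable_const 1).indicator (alg.measurableSet_accept r x y)

variable {P} {r : ℕ} {𝒮 : Set (List (Update (N + 3) 1))}

lemma le_measureReal_better (h𝒮 : ∀ σ, IntegerBounded 3 σ → σ ∈ 𝒮)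
    (hsol : alg.SolvesCenters P r 𝒮) (x y : Finset (Fin N)) :
    2 / 3 ≤ P.real {ω | BetterThanTwo (streamMatrix (pairStream x y))
      (alg.result r ω (pairStream x y))} := by
  have h := hsol _ (h𝒮 _ (integerBounded_pairStream x y))
  have := ENNReal.toReal_mono (measure_ne_top _ _) h
  simpa [Measure.real] using this

lemma le_integral_accept (h𝒮 : ∀ σ, IntegerBounded 3 σ → σ ∈ 𝒮)
    (hsol : alg.SolvesCenters P r 𝒮) (x y : Finset (Fin N)) (hxy : Disjoint x y) :
    2 / 3 ≤ ∫ ω, alg.accept r ω x y ∂P := by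
  rw [integral_accept]
  exact (alg.le_measureReal_better h𝒮 hsol x y).trans (measureReal_mono
    fun ω hω => hasPaddingCenters_of_disjoint x y hxy _ hω)

/-- Success lies in the complement of acceptance. Only acceptance has to be measurable; success
enters by monotonicity alone. -/
lemma integral_accept_le (h𝒮 : ∀ σ, IntegerBounded 3 σ → σ ∈ 𝒮)
    (hsol : alg.SolvesCenters P r 𝒮) (x y : Finset (Fin N)) (i : Fin N) (hxy : x ∩ y = {i}) :
    ∫ ω, alg.accept r ω x y ∂P ≤ 1 / 3 := by
  rw [integral_accept]
  have h1 := (alg.le_measureReal_better h𝒮 hsol x y).trans (measureReal_mono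
    (s₂ := {ω | HasPaddingCenters (alg.result r ω (pairStream x y))}ᶜ)
    fun ω hω hacc => not_betterThanTwo_of_meet x y i hxy _ hacc hω)
  rw [probReal_compl_eq_one_sub (alg.measurableSet_accept r x y)] at h1
  linarith

/-- The number of rectangles into which the algorithm splits the pairs of sets is
exponential. -/
theorem rectangles_lower_bound (hN : 0 < N) (h𝒮 : ∀ σ, IntegerBounded 3 σ → σ ∈ 𝒮)
    (hsol : alg.SolvesCenters P r 𝒮) :
    1 / 280 ≤ (2 ^ M * (2 ^ M * 2 ^ M) ^ r : ℝ) * corruptionError N := by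
  set K : ℝ := 2 ^ M * (2 ^ M * 2 ^ M) ^ r with hK
  set a : Finset (Fin N) → Finset (Fin N) → ℝ := fun x y => ∫ ω, alg.accept r ω x y ∂P with ha
  have hdI : Integrable (fun ω => disjointSum (alg.accept r ω)) P :=
    integrable_finsetSum _ fun p _ => alg.integrable_accept P r _ _
  have hmI : Integrable (fun ω => meetSum (alg.accept r ω)) P :=
    integrable_finsetSum _ fun p _ => alg.integrable_accept P r _ _
  have hd : ∫ ω, disjointSum (alg.accept r ω) ∂P = disjointSum a :=
    integral_finsetSum _ fun p _ => alg.integrable_accept P r _ _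
  have hm : ∫ ω, meetSum (alg.accept r ω) ∂P = meetSum a :=
    integral_finsetSum _ fun p _ => alg.integrable_accept P r _ _
  have hcor : ∀ ω, (N : ℝ) * (13 / 100 * disjointSum (alg.accept r ω) -
      K * (14 / 15 * (8 ^ N * corruptionError N))) ≤ meetSum (alg.accept r ω) := by
    intro ω
    have := (alg.isRectangleSum_accept r ω).corruption
    simpa [hK] using this
  -- The corruption bound holds for every outcome of the coins, hence for the acceptance
  -- probabilities.
  have hint : (N : ℝ) * (13 / 100 * disjointSum a -
      K * (14 / 15 * (8 ^ N * corruptionError N))) ≤ meetSum a := by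
    have hsub := (hdI.const_mul (13 / 100)).sub
      (integrable_const (μ := P) (K * (14 / 15 * (8 ^ N * corruptionError N))))
    have := integral_mono (hsub.const_mul (N : ℝ)) hmI hcor
    rw [integral_const_mul, integral_sub' (hdI.const_mul _) (integrable_const _),
      integral_const_mul, integral_const, hd, hm, probReal_univ, one_smul] at this
    exact this
  have hlow : 2 / 3 * 8 ^ N ≤ disjointSum a := by
    have h8 : (8 : ℝ) ^ N = 2 ^ N * (2 ^ N * 2 ^ N) := by
      rw [← mul_pow, ← mul_pow]; norm_num
    calc (2 / 3 * 8 ^ N : ℝ)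
        = ∑ _p : Finset (Fin N) × Finset (Fin N) × Finset (Fin N), (2 / 3 : ℝ) := by
          simp [h8, mul_comm]
      _ ≤ disjointSum a := Finset.sum_le_sum fun p _ =>
          alg.le_integral_accept h𝒮 hsol _ _ (by
            rw [Finset.disjoint_left]
            intro i h1 h2
            exact Finset.mem_compl.1 (Finset.mem_inter.1 h2).2 (Finset.mem_inter.1 h1).2)
  have hup : meetSum a ≤ N * 8 ^ N / 12 := by
    calc meetSum a ≤ ∑ _q ∈ meetIndex (Fin N), (1 / 3 : ℝ) := by
          refine Finset.sum_le_sum fun q hq => alg.integral_accept_le h𝒮 hsol _ _ q.1 ?_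
          simp only [meetIndex, Finset.mem_filter, Finset.mem_univ, true_and] at hq
          ext j
          simp only [Finset.mem_inter, Finset.mem_insert, Finset.mem_compl,
            Finset.mem_singleton]
          constructor
          · rintro ⟨⟨-, h1⟩, -, h2⟩
            tauto
          · rintro rfl
            exact ⟨⟨hq.1, Or.inl rfl⟩, hq.2, Or.inl rfl⟩
      _ = N * 8 ^ N / 12 := by
          rw [Finset.sum_const, nsmul_eq_mul, card_meetIndex, Fintype.card_fin]
          ring
  have hN' : (0 : ℝ) < N := by exact_mod_cast hN
  have h8 : (0 : ℝ) < 8 ^ N := by positivity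
  have h1 : 13 / 100 * disjointSum a - K * (14 / 15 * (8 ^ N * corruptionError N)) ≤
      8 ^ N / 12 := by
    refine le_of_mul_le_mul_left ?_ hN'
    linarith
  -- 13/100 · 2/3 - 1/12 = 1/300, and 1/300 divided by 14/15 is 1/280.
  have h2 : (8 : ℝ) ^ N * (1 / 280) ≤ 8 ^ N * (K * corruptionError N) := by linarith
  exact le_of_mul_le_mul_left h2 h8

end StreamingAlgorithm

end KMeansStream

/-! ### From the number of rectangles to the memory bound -/

theorem mainTheorem10 (r : ℕ) :
    ∃ c : ℝ, 0 < c ∧ ∃ n₀ : ℕ, ∀ n : ℕ, n₀ ≤ n →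
      ∀ 𝒮 : Set (List (KMeansStream.Update n 1)),
        (∀ σ, KMeansStream.IntegerBounded 3 σ → σ ∈ 𝒮) →
      ∀ (M : ℕ) (Ω : Type u) [MeasurableSpace Ω] (P : MeasureTheory.Measure Ω)
        [MeasureTheory.IsProbabilityMeasure P]
        (alg : KMeansStream.StreamingAlgorithm Ω n 1 3 M),
        alg.SolvesCenters P r 𝒮 → c * (n : ℝ) ≤ (M : ℝ) := by
  set α : ℝ := -Real.log KMeansStream.biasBase / 280 with hα
  have hα0 : 0 < α := by
    have := Real.log_neg KMeansStream.biasBase_pos KMeansStream.biasBase_lt_one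
    rw [hα]
    linarith
  have hlog : 0 < Real.log 2 := Real.log_pos one_lt_two
  -- From `n₁` on, half of `α * n` absorbs `log 280` and the loss `3 * α` due to `N = n - 3`. The
  -- maximum with 4 below makes `N` positive.
  obtain ⟨n₁, hn₁⟩ := exists_nat_ge ((Real.log 280 + 3 * α) / (α / 2))
  rw [div_le_iff₀ (by positivity)] at hn₁
  refine ⟨α / 2 / ((2 * r + 1) * Real.log 2), by positivity, max n₁ 4, ?_⟩
  intro n hn 𝒮 h𝒮 M Ω _ P _ alg hsol
  obtain ⟨N, rfl⟩ : ∃ N, n = N + 3 := ⟨n - 3, by omega⟩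
  have hb := alg.rectangles_lower_bound (by omega) h𝒮 hsol
  have hK : (2 ^ M * (2 ^ M * 2 ^ M) ^ r : ℝ) = 2 ^ (M * (2 * r + 1)) := by
    rw [← pow_add, ← pow_mul, ← pow_add]
    congr 1
    ring
  rw [hK] at hb
  have hl := Real.log_le_log (by norm_num) hb
  rw [KMeansStream.corruptionError, Real.log_mul (by positivity) (Real.exp_pos _).ne',
    Real.log_pow, Real.log_exp, one_div, Real.log_inv] at hl
  have hn' : (n₁ : ℝ) ≤ (N + 3 : ℕ) := by exact_mod_cast (le_max_left _ _).trans hn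
  have hmul := mul_le_mul_of_nonneg_right hn' (by positivity : 0 ≤ α / 2)
  rw [div_mul_eq_mul_div, div_le_iff₀ (by positivity)]
  push_cast at *
  have hαN : Real.log KMeansStream.biasBase / 280 * (N : ℝ) = -(α * N) := by
    rw [hα]; ring
  rw [hαN] at hl
  linarith
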